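/- Let $c\in\mathbb{R}$, $s>0$ and $a>0$. Let $X_c$ be the set of measurable $\varphi:\mathbb{R}^+\to\mathbb{C}$ with $\int_0^\infty|\varphi(u)|u^{c-1}\,du<\infty$, and for $\varphi\in X_c$ put $[\varphi]^\wedge(c+it)=\int_0^\infty u^{c+it-1}\varphi(u)\,du$ ($t\in\mathbb{R}$). For $h,\sigma>0$ let $$(\tau_h^c\varphi)(x)=h^c\varphi(hx),\qquad R_{c,\sigma}[\varphi]=-\sum_{k\in\mathbb{Z},\,k\neq0}[\varphi]^\wedge(c+2\pi i\sigma k).$$ Let $\mathcal{K}_c(s)$ be the class of continuous $\varphi\in X_c$ such that $\sum_{k\in\mathbb{Z}}|\varphi(e^{k/\sigma})|e^{kc/\sigma}<\infty$ and $\sum_{k\in\mathbb{Z}}|[\varphi]^\wedge(c+2\pi ik\sigma)|<\infty$ for all $\sigma\ge s$, and let $\mathcal{M}^1_c$ be the class of continuous $\varphi\in X_c$ with $\int_{-\infty}^\infty|[\varphi]^\wedge(c+it)|\,dt<\infty$. For $b>0$ let $\mathbb{H}_b=\{(r,\theta): r>0,\ -b<\theta<b\}$. Let $H^*_c(\mathbb{H}_a)$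 be the class of functions $f:\mathbb{H}_a\to\mathbb{C}$ such that (a) $f$ is polar-analytic, that is, for each $(r_0,\theta_0)\in\mathbb{H}_a$ the limit $\displaystyle\lim_{(r,\theta)\to(r_0,\theta_0)}\frac{f(r,\theta)-f(r_0,\theta_0)}{re^{i\theta}-r_0e^{i\theta_0}}$ exists in $\mathbb{C}$; (b) $\lim_{r\to0^+}r^cf(r,0)=\lim_{r\to+\infty}r^cf(r,0)=0$; (c) for every $\varepsilon\in(0,a)$ there is a constant $K(f,\varepsilon)$ such that $|f(r,\theta)|\le r^{-c}K(f,\varepsilon)$ for all $(r,\theta)\in\mathbb{H}_{a-\varepsilon}$; (d) there is a constant $K(f)$ such that for every $\theta\in(-a,a)$ and every $t\in\mathbb{R}$ the limit $\lim_{R\to+\infty}\int_{1/R}^R f(r,\theta)r^{c+it-1}\,dr$ exists and has absolute value at most $K(f)$. Let $\varphi\in\mathcal{K}_c(s)\cap\mathcal{M}^1_c$. Then the following are equivalent: (i) there exists $f\in H^*_c(\mathbb{H}_a)$ with $f(r,0)=\varphi(r)$ for all $r>0$; (ii) $R_{c,\sigma}[\tau_h^c\varphi]=\mathcal{O}(e^{-2\pi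 a\sigma})$ as $\sigma\to+\infty$, uniformly for $h\in[e^{-1/(2\sigma)},e^{1/(2\sigma)}]$; that is, there are constants $C$ and $\sigma_0>0$ such that $|R_{c,\sigma}[\tau_h^c\varphi]|\le Ce^{-2\pi a\sigma}$ for all $\sigma\ge\sigma_0$ and all $h\in[e^{-1/(2\sigma)},e^{1/(2\sigma)}]$. -/

import Mathlib

open Filter Topology Set MeasureTheory

noncomputable section

namespace MellinQuadrature

/-! A function `ℝ⁺ → ℂ` is modelled by a function `φ : ℝ → ℂ` of which only the values on `Ioi 0`
matter; a function on the strip `ℍ_a` by a function `f : ℝ × ℝ → ℂ` of the polar coordinates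
`(r, θ)` of which only the values on the strip matter. The Mellin transform
`∫_0^∞ u^(s-1) φ(u) du` is Mathlib's `mellin φ s`. -/

/-- `φ ∈ X_c`: the function `x ↦ φ(x) x^(c-1)` lies in `L¹(ℝ⁺)`. -/
def MemX (c : ℝ) (φ : ℝ → ℂ) : Prop :=
  IntegrableOn (fun x : ℝ => φ x * ((x ^ (c - 1) : ℝ) : ℂ)) (Ioi 0)

/-- The Mellin translation `(τ_h^c φ)(x) = h^c φ(h x)`. -/
def mellinTranslate (c h : ℝ) (φ : ℝ → ℂ) : ℝ → ℂ :=
  fun x => ((h ^ c : ℝ) : ℂ) * φ (h * x)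

/-- The Mellin inversion class `𝓜¹_c`: continuous functions in `X_c` whose Mellin transform is
integrable on the line `c + iℝ`. -/
structure MemInversionClass (c : ℝ) (φ : ℝ → ℂ) : Prop where
  memX : MemX c φ
  continuousOn : ContinuousOn φ (Ioi 0)
  integrable_mellin : Integrable (fun t : ℝ => mellin φ ((c : ℂ) + t * Complex.I))

/-- The class `𝓚_c(s)`. -/
structure MemK (c s : ℝ) (φ : ℝ → ℂ) : Prop where
  memX : MemX c φ
  continuousOn : ContinuousOn φ (Ioi 0)
  summable_samples : ∀ σ : ℝ, s ≤ σ →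
    Summable (fun k : ℤ => ‖φ (Real.exp (k / σ))‖ * Real.exp (k * c / σ))
  summable_mellin : ∀ σ : ℝ, s ≤ σ →
    Summable (fun k : ℤ => ‖mellin φ ((c : ℂ) + ((2 * Real.pi * k * σ : ℝ) : ℂ) * Complex.I)‖)

/-- The remainder `R_{c,σ}[φ] = - ∑_{k ∈ ℤ, k ≠ 0} [φ]^_{M_c}(c + 2πiσk)`. -/
def remainder (c σ : ℝ) (φ : ℝ → ℂ) : ℂ :=
  -∑' k : {k : ℤ // k ≠ 0},
    mellin φ ((c : ℂ) + ((2 * Real.pi * (k : ℤ) * σ : ℝ) : ℂ) * Complex.I)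

/-- The strip `ℍ_a = {(r, θ) : r > 0, -a < θ < a}`. -/
def strip (a : ℝ) : Set (ℝ × ℝ) := Ioi 0 ×ˢ Ioo (-a) a

/-- The point `r e^{iθ}` of the plane with polar coordinates `p = (r, θ)`. -/
def polarPoint (p : ℝ × ℝ) : ℂ := (p.1 : ℂ) * Complex.exp (Complex.I * p.2)

/-- Polar-analyticity on `D`: at each point of `D` the polar difference quotient has a limit. -/
def PolarAnalyticOn (f : ℝ × ℝ → ℂ) (D : Set (ℝ × ℝ)) : Prop :=
  ∀ p ∈ D, ∃ L : ℂ,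
    Tendsto (fun q : ℝ × ℝ => (f q - f p) / (polarPoint q - polarPoint p)) (𝓝[D \ {p}] p) (𝓝 L)

/-- The class `H*_c(ℍ_a)`. The constant in `bounded` may depend on `ε`, the one in
`mellin_bounded` depends on `f` only. -/
structure MemHStar (c a : ℝ) (f : ℝ × ℝ → ℂ) : Prop where
  polarAnalytic : PolarAnalyticOn f (strip a)
  tendsto_zero : Tendsto (fun r : ℝ => ((r ^ c : ℝ) : ℂ) * f (r, 0)) (𝓝[>] 0) (𝓝 0)
  tendsto_atTop : Tendsto (fun r : ℝ => ((r ^ c : ℝ) : ℂ) * f (r, 0)) atTop (𝓝 0)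
  bounded : ∀ ε ∈ Ioo 0 a, ∃ K : ℝ, ∀ p ∈ strip (a - ε), ‖f p‖ ≤ p.1 ^ (-c) * K
  mellin_bounded : ∃ K : ℝ, ∀ θ ∈ Ioo (-a) a, ∀ t : ℝ, ∃ l : ℂ,
    Tendsto (fun R : ℝ =>
      ∫ r in (1 / R)..R, f (r, θ) * (r : ℂ) ^ ((c : ℂ) + t * Complex.I - 1)) atTop (𝓝 l) ∧
    ‖l‖ ≤ K

end MellinQuadrature

end

/-!
Write `G t = mellin φ (c + it)` and pass to the logarithmic coordinate `z = log r + iθ`, in which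
`ℍ_a` is the strip `|Im z| < a`, polar-analytic functions are the holomorphic ones
(`polarAnalyticOn_strip_iff`) and the Mellin transform on the line `c + iℝ` is a Fourier integral.
Both sides of the equivalence are shown to say that `‖G t‖ ≤ K e^{-a|t|}` for some `K`.

*The remainder.* For `h = e^{v/σ}` the remainder of `τ_h φ` is minus the trigonometric series
`∑_{k ≠ 0} G(2πkσ) e^{-2πikv}`, and the admissible `h` correspond to `v` in a full period. Hence a
uniform bound on the remainder bounds each coefficient; those with `k = ±1` give the decay of `G`
(`exists_mellin_decay_of_remainder`). Conversely the decay of `G` bounds the series by a geometric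
one (`exists_remainder_bound_of_mellin_decay`).

*From an extension to decay.* Given `f`, the integral of `f(e^x, y) e^{(c+it)z}`, `z = x + iy`, along
`Im z = θ` has modulus at most `K e^{-tθ}` by condition (d), and along the real axis it is `G t`. The
two agree by `horizontal_limits_eq`: in Cauchy's theorem on a rectangle of half-width `L`, the
contribution of the vertical sides has a limit as `L → ∞`, and its primitive in `L` is bounded, by
Fubini, boundedness of `r^c f` on smaller strips and integrability on the axis, so the limit is
zero. Letting `θ → ±a` gives the decay (`exists_mellin_decay_of_memHStar`).

*From decay to an extension.* The inverse Mellin integral of `G` converges on the whole strip and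
defines `mellinExtension c φ`, equal to `φ` on the axis by Mellin inversion. The Riemann–Lebesgue
lemma on each horizontal line allows the contour shift (`tendsto_integral_shift`) that evaluates the
integrals of condition (d) (`memHStar_mellinExtension`).
-/

open Filter Topology Set MeasureTheory

namespace MellinQuadrature

/-! ### Contour shifting in a horizontal strip -/

/-- The horizontal strip `{z : |Im z| < a}`, the image of `ℍ_a` under
`(r, θ) ↦ log r + iθ`. -/
def horizontalStrip (a : ℝ) : Set ℂ := {z | |z.im| < a}

theorem isOpen_horizontalStrip (a : ℝ) : IsOpen (horizontalStrip a) :=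
  isOpen_lt (by fun_prop) continuous_const

/-- Cauchy's theorem for a rectangle with one side on the real axis. -/
theorem integral_shift {h : ℂ → ℂ} {a θ : ℝ} (hd : DifferentiableOn ℂ h (horizontalStrip a))
    (hθ : |θ| < a) (x₁ x₂ : ℝ) :
    ∫ x : ℝ in x₁..x₂, h (x + θ * Complex.I) =
      (∫ x : ℝ in x₁..x₂, h x) + Complex.I * (∫ y : ℝ in (0 : ℝ)..θ, h (x₂ + y * Complex.I)) -
        Complex.I * ∫ y : ℝ in (0 : ℝ)..θ, h (x₁ + y * Complex.I) := by
  have key := Complex.integral_boundary_rect_eq_zero_of_differentiableOn h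
    (x₁ : ℂ) (x₂ + θ * Complex.I) (hd.mono ?_)
  · simp only [Complex.ofReal_re, Complex.ofReal_im, Complex.add_re, Complex.mul_re, Complex.I_re,
      Complex.I_im, Complex.add_im, Complex.mul_im, smul_eq_mul, Complex.ofReal_zero, mul_zero,
      zero_mul, add_zero, sub_zero, mul_one, zero_add] at key
    linear_combination -key
  · intro z hz
    have h2 : z.im ∈ uIcc 0 θ := by simpa using hz.2
    have h3 := abs_sub_left_of_mem_uIcc h2
    simp only [sub_zero] at h3
    exact lt_of_le_of_lt h3 hθ

/-- A function with a limit at infinity and bounded primitive has limit zero. -/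
theorem eq_zero_of_tendsto_of_integral_bounded {V : ℝ → ℂ} {v : ℂ} {B : ℝ}
    (hV : ∀ x y : ℝ, IntervalIntegrable V volume x y) (hlim : Tendsto V atTop (𝓝 v))
    (hB : ∀ L : ℝ, 0 ≤ L → ‖∫ x in (0 : ℝ)..L, V x‖ ≤ B) : v = 0 := by
  by_contra hv
  have hv' : 0 < ‖v‖ := norm_pos_iff.mpr hv
  obtain ⟨L₁, hL₁⟩ := (Metric.tendsto_atTop.mp hlim) (‖v‖ / 2) (by positivity)
  set L₀ := max L₁ 0 with hL₀
  have hB0 : 0 ≤ B := (norm_nonneg _).trans (hB 0 le_rfl)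
  -- Beyond `L₀` the integral of `V` grows at least like `(L - L₀) ‖v‖ / 2`, and it is at most `2B`.
  set L := L₀ + (4 * B + 1) / ‖v‖ with hL
  have hd : 0 < (4 * B + 1) / ‖v‖ := by positivity
  have hLL : L₀ ≤ L := by linarith
  have h0 : 0 ≤ L₀ := le_max_right _ _
  have h1 : ‖∫ x in L₀..L, (V x - v)‖ ≤ ‖v‖ / 2 * |L - L₀| := by
    apply intervalIntegral.norm_integral_le_of_norm_le_const
    intro x hx
    rw [uIoc_of_le hLL] at hx
    have := hL₁ x ((le_max_left _ _).trans hx.1.le)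
    rw [dist_eq_norm] at this
    exact this.le
  rw [intervalIntegral.integral_sub (hV _ _) intervalIntegrable_const,
    ← intervalIntegral.integral_interval_sub_left (hV 0 L) (hV 0 L₀),
    intervalIntegral.integral_const, abs_of_nonneg (by linarith)] at h1
  have h2 : ‖(L - L₀) • v‖ = (L - L₀) * ‖v‖ := by
    rw [norm_smul, Real.norm_of_nonneg (by linarith)]
  have h3 : (L - L₀) * ‖v‖ = 4 * B + 1 := by
    rw [hL, add_sub_cancel_left, div_mul_cancel₀ _ hv'.ne']
  have h4 := hB L (by linarith)
  have h5 := hB L₀ h0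
  have h6 := norm_sub_norm_le ((L - L₀) • v)
    ((∫ x in (0 : ℝ)..L, V x) - ∫ x in (0 : ℝ)..L₀, V x)
  rw [norm_sub_rev ((L - L₀) • v)] at h6
  have h7 := norm_sub_le (∫ x in (0 : ℝ)..L, V x) (∫ x in (0 : ℝ)..L₀, V x)
  linarith

theorem intervalIntegral_swap_of_continuousOn {k : ℝ → ℝ → ℂ} {a b c d : ℝ}
    (hk : ContinuousOn (Function.uncurry k) (uIcc a b ×ˢ uIcc c d)) :
    ∫ x in a..b, ∫ y in c..d, k x y = ∫ y in c..d, ∫ x in a..b, k x y := by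
  apply intervalIntegral_intervalIntegral_swap
  exact (hk.integrableOn_compact (isCompact_uIcc.prod isCompact_uIcc)).mono_set
    (prod_mono uIoc_subset_uIcc uIoc_subset_uIcc)

section ContourShift

variable {h : ℂ → ℂ} {a θ : ℝ}

theorem norm_integral_vertical_le {M : ℝ} (hM : ∀ z : ℂ, |z.im| ≤ |θ| → ‖h z‖ ≤ M) (x η : ℝ)
    (hη : |η| ≤ |θ|) : ‖∫ y : ℝ in (0 : ℝ)..η, h (x + y * Complex.I)‖ ≤ M * |θ| := by
  have hM0 : 0 ≤ M := (norm_nonneg _).trans (hM 0 (by simp))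
  calc ‖∫ y : ℝ in (0 : ℝ)..η, h (x + y * Complex.I)‖ ≤ M * |η - 0| := by
        apply intervalIntegral.norm_integral_le_of_norm_le_const
        intro y hy
        apply hM
        have h3 := abs_sub_left_of_mem_uIcc (uIoc_subset_uIcc hy)
        simp only [sub_zero] at h3
        simpa using h3.trans hη
    _ ≤ M * |θ| := by rw [sub_zero]; gcongr

theorem norm_integral_horizontal_le {M B : ℝ} (hd : DifferentiableOn ℂ h (horizontalStrip a))
    (hθ : |θ| < a) (hM : ∀ z : ℂ, |z.im| ≤ |θ| → ‖h z‖ ≤ M)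
    (hB : ∀ L : ℝ, ‖∫ x : ℝ in (0 : ℝ)..L, h x‖ ≤ B) (L y : ℝ) (hy : |y| ≤ |θ|) :
    ‖∫ x : ℝ in (0 : ℝ)..L, h (x + y * Complex.I)‖ ≤ B + M * |θ| + M * |θ| := by
  rw [integral_shift hd (hy.trans_lt hθ)]
  refine (norm_sub_le _ _).trans (add_le_add ((norm_add_le _ _).trans (add_le_add (hB L) ?_)) ?_)
  · rw [norm_mul, Complex.norm_I, one_mul]
    exact norm_integral_vertical_le hM L y hy
  · rw [norm_mul, Complex.norm_I, one_mul]
    exact norm_integral_vertical_le hM 0 y hy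

/-- The primitive of the vertical integral of `h` between heights `0` and `θ` is bounded: by
Fubini it is an integral over `y` of horizontal integrals, each comparable to the one on the real axis. -/
theorem norm_integral_integral_vertical_le {M B : ℝ}
    (hd : DifferentiableOn ℂ h (horizontalStrip a))
    (hθ : |θ| < a) (hM : ∀ z : ℂ, |z.im| ≤ |θ| → ‖h z‖ ≤ M)
    (hB : ∀ L : ℝ, ‖∫ x : ℝ in (0 : ℝ)..L, h x‖ ≤ B) (L : ℝ) :
    ‖∫ x : ℝ in (0 : ℝ)..L, ∫ y : ℝ in (0 : ℝ)..θ, h (x + y * Complex.I)‖ ≤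
      (B + M * |θ| + M * |θ|) * |θ| := by
  rw [intervalIntegral_swap_of_continuousOn]
  · have : ‖∫ y : ℝ in (0 : ℝ)..θ, ∫ x : ℝ in (0 : ℝ)..L, h (x + y * Complex.I)‖ ≤
      (B + M * |θ| + M * |θ|) * |θ - 0| := by
      apply intervalIntegral.norm_integral_le_of_norm_le_const
      intro y hy
      apply norm_integral_horizontal_le hd hθ hM hB
      have h3 := abs_sub_left_of_mem_uIcc (uIoc_subset_uIcc hy)
      simpa only [sub_zero] using h3
    simpa using this
  · refine hd.continuousOn.comp (by fun_prop) ?_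
    rintro ⟨x, y⟩ ⟨-, hy⟩
    have h3 := abs_sub_left_of_mem_uIcc hy
    simp only [sub_zero] at h3
    simpa [horizontalStrip] using h3.trans_lt hθ

theorem continuous_integral_vertical (hd : DifferentiableOn ℂ h (horizontalStrip a))
    (hθ : |θ| < a) : Continuous fun x : ℝ => ∫ y : ℝ in (0 : ℝ)..θ, h (x + y * Complex.I) := by
  have hc : ∀ η : ℝ, |η| < a → Continuous fun x : ℝ => h (x + η * Complex.I) := fun η hη =>
    hd.continuousOn.comp_continuous (by fun_prop) (by simpa [horizontalStrip] using hη)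
  have h0 := hc 0 (by simpa using (abs_nonneg θ).trans_lt hθ)
  simp only [Complex.ofReal_zero, zero_mul, add_zero] at h0
  have e : (fun x : ℝ => ∫ y : ℝ in (0 : ℝ)..θ, h (x + y * Complex.I)) = fun x : ℝ =>
      -Complex.I * ((∫ t : ℝ in (0 : ℝ)..x, h (t + θ * Complex.I)) - ∫ t : ℝ in (0 : ℝ)..x, h t) +
        ∫ y : ℝ in (0 : ℝ)..θ, h ((0 : ℝ) + y * Complex.I) := by
    funext x
    rw [integral_shift hd hθ]
    linear_combination ((∫ y : ℝ in (0 : ℝ)..θ, h (x + y * Complex.I)) -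
      (∫ y : ℝ in (0 : ℝ)..θ, h ((0 : ℝ) + y * Complex.I))) * Complex.I_mul_I
  rw [e]
  exact ((continuous_const.mul ((intervalIntegral.continuous_primitive
    (fun _ _ => (hc θ hθ).intervalIntegrable _ _) 0).sub (intervalIntegral.continuous_primitive
    (fun _ _ => h0.intervalIntegrable _ _) 0))).add continuous_const)

/-- Improper integrals over two horizontal lines agree as soon as both exist, `h` is bounded
between the lines and its partial integrals on the real axis are bounded. No decay of `h` in the
horizontal direction is assumed: the vertical contributions have a limit and a bounded primitive,
so their limit is zero. -/
theorem horizontal_limits_eq {M B : ℝ} {G l : ℂ}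
    (hd : DifferentiableOn ℂ h (horizontalStrip a))
    (hθ : |θ| < a) (hM : ∀ z : ℂ, |z.im| ≤ |θ| → ‖h z‖ ≤ M)
    (hB : ∀ L : ℝ, ‖∫ x : ℝ in (0 : ℝ)..L, h x‖ ≤ B)
    (hG : Tendsto (fun L : ℝ => ∫ x : ℝ in (-L)..L, h x) atTop (𝓝 G))
    (hl : Tendsto (fun L : ℝ => ∫ x : ℝ in (-L)..L, h (x + θ * Complex.I)) atTop (𝓝 l)) :
    l = G := by
  set W : ℝ → ℂ := fun x => ∫ y : ℝ in (0 : ℝ)..θ, h (x + y * Complex.I) with hW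
  have hWc : Continuous W := continuous_integral_vertical hd hθ
  have hWc' : Continuous fun x => W (-x) := hWc.comp continuous_neg
  have hlim : Tendsto (fun x => W x - W (-x)) atTop (𝓝 (-Complex.I * (l - G))) := by
    refine ((hl.sub hG).const_mul (-Complex.I)).congr fun L => ?_
    rw [integral_shift hd hθ]
    simp only [hW]
    push_cast
    linear_combination (-(∫ y : ℝ in (0 : ℝ)..θ, h (L + y * Complex.I)) +
      (∫ y : ℝ in (0 : ℝ)..θ, h (-L + y * Complex.I))) * Complex.I_mul_I
  have h0 := eq_zero_of_tendsto_of_integral_bounded (V := fun x => W x - W (-x))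
    (B := (B + M * |θ| + M * |θ|) * |θ| + (B + M * |θ| + M * |θ|) * |θ|)
    (fun x y => (hWc.sub hWc').intervalIntegrable _ _) hlim (fun L _ => ?_)
  · have := (mul_eq_zero.mp h0).resolve_left (neg_ne_zero.mpr Complex.I_ne_zero)
    exact sub_eq_zero.mp this
  · rw [intervalIntegral.integral_sub (hWc.intervalIntegrable _ _) (hWc'.intervalIntegrable _ _)]
    refine (norm_sub_le _ _).trans (add_le_add ?_ ?_)
    · exact norm_integral_integral_vertical_le hd hθ hM hB L
    · rw [intervalIntegral.integral_comp_neg, neg_zero, intervalIntegral.integral_symm, norm_neg]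
      exact norm_integral_integral_vertical_le hd hθ hM hB (-L)

/-- Moving a symmetric improper integral from the real axis to the line `Im z = θ`, for a bounded
function that decays pointwise in the horizontal direction. -/
theorem tendsto_integral_shift {M : ℝ} {G : ℂ}
    (hd : DifferentiableOn ℂ h (horizontalStrip a))
    (hθ : |θ| < a) (hM : ∀ z : ℂ, |z.im| ≤ |θ| → ‖h z‖ ≤ M)
    (hdecay : ∀ y : ℝ, |y| < a →
      Tendsto (fun x : ℝ => h (x + y * Complex.I)) (cocompact ℝ) (𝓝 0))
    (hG : Tendsto (fun L : ℝ => ∫ x : ℝ in (-L)..L, h x) atTop (𝓝 G)) :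
    Tendsto (fun L : ℝ => ∫ x : ℝ in (-L)..L, h (x + θ * Complex.I)) atTop (𝓝 G) := by
  have hy : ∀ y ∈ uIoc 0 θ, |y| ≤ |θ| := fun y hy => by
    have h3 := abs_sub_left_of_mem_uIcc (uIoc_subset_uIcc hy)
    simpa only [sub_zero] using h3
  have hvert : ∀ l : Filter ℝ, l.IsCountablyGenerated → l ≤ cocompact ℝ →
      Tendsto (fun x : ℝ => ∫ y : ℝ in (0 : ℝ)..θ, h (x + y * Complex.I)) l (𝓝 0) := by
    intro l _ hl
    have := intervalIntegral.tendsto_integral_filter_of_dominated_convergence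
      (F := fun (x y : ℝ) => h (x + y * Complex.I)) (f := fun _ => 0) (l := l)
      (μ := volume) (a := 0) (b := θ) (fun _ => M) ?_ ?_ intervalIntegrable_const ?_
    · simpa using this
    · refine Eventually.of_forall fun x => ?_
      refine ContinuousOn.aestronglyMeasurable ?_ measurableSet_uIoc
      exact hd.continuousOn.comp (by fun_prop) fun y hy' => by
        simpa [horizontalStrip] using (hy y hy').trans_lt hθ
    · exact Eventually.of_forall fun x => Eventually.of_forall fun y hy' =>
        hM _ (by simpa using hy y hy')
    · exact Eventually.of_forall fun y hy' => (hdecay y ((hy y hy').trans_lt hθ)).mono_left hl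
  have htop := hvert atTop inferInstance (by rw [cocompact_eq_atBot_atTop]; exact le_sup_right)
  have hbot := hvert atBot inferInstance (by rw [cocompact_eq_atBot_atTop]; exact le_sup_left)
  have := (hG.add (htop.const_mul Complex.I)).sub
    ((hbot.comp tendsto_neg_atTop_atBot).const_mul Complex.I)
  simp only [mul_zero, add_zero, sub_zero] at this
  exact this.congr fun L => (integral_shift hd hθ _ _).symm

end ContourShift

/-! ### Logarithmic coordinates -/

/-- The point of `ℍ_a` with logarithmic coordinate `z = log r + iθ`. -/
noncomputable def ofLogCoord (z : ℂ) : ℝ × ℝ := (Real.exp z.re, z.im)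

/-- The logarithmic coordinate `log r + iθ` of the point `(r, θ)`. -/
noncomputable def logCoord (p : ℝ × ℝ) : ℂ := Real.log p.1 + p.2 * Complex.I

theorem logCoord_ofLogCoord (z : ℂ) : logCoord (ofLogCoord z) = z := by
  simp [logCoord, ofLogCoord, Complex.re_add_im]

theorem ofLogCoord_logCoord {p : ℝ × ℝ} (hp : 0 < p.1) : ofLogCoord (logCoord p) = p := by
  ext <;> simp [logCoord, ofLogCoord, Real.exp_log hp]

theorem polarPoint_ofLogCoord (z : ℂ) : polarPoint (ofLogCoord z) = Complex.exp z := by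
  conv_rhs => rw [← Complex.re_add_im z, Complex.exp_add]
  simp [polarPoint, ofLogCoord, mul_comm]

theorem continuous_ofLogCoord : Continuous ofLogCoord := by
  unfold ofLogCoord; fun_prop

theorem continuousAt_logCoord {p : ℝ × ℝ} (hp : 0 < p.1) : ContinuousAt logCoord p := by
  have : ContinuousAt (fun q : ℝ × ℝ => Real.log q.1) p :=
    continuousAt_fst.log hp.ne'
  unfold logCoord
  fun_prop

theorem ofLogCoord_mem_strip {a : ℝ} {z : ℂ} : ofLogCoord z ∈ strip a ↔ z ∈ horizontalStrip a := by
  simp [ofLogCoord, strip, horizontalStrip, Real.exp_pos, abs_lt]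

theorem logCoord_mem_horizontalStrip {a : ℝ} {p : ℝ × ℝ} (hp : p ∈ strip a) :
    logCoord p ∈ horizontalStrip a := by
  rwa [← ofLogCoord_mem_strip, ofLogCoord_logCoord hp.1]

theorem tendsto_slope_exp (z : ℂ) :
    Tendsto (slope Complex.exp z) (𝓝[≠] z) (𝓝 (Complex.exp z)) :=
  hasDerivAt_iff_tendsto_slope.mp (Complex.hasDerivAt_exp z)

/-- Polar-analyticity is holomorphy in the logarithmic coordinate. The two difference quotients
differ by the factor `(e^w - e^z) / (w - z)`, which tends to `e^z ≠ 0`. -/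
theorem polarAnalyticOn_strip_iff {f : ℝ × ℝ → ℂ} {a : ℝ} :
    PolarAnalyticOn f (strip a) ↔
      DifferentiableOn ℂ (fun z => f (ofLogCoord z)) (horizontalStrip a) := by
  constructor
  · intro hf z hz
    obtain ⟨L, hL⟩ := hf _ (ofLogCoord_mem_strip.mpr hz)
    have ht : Tendsto ofLogCoord (𝓝[≠] z) (𝓝[strip a \ {ofLogCoord z}] ofLogCoord z) := by
      refine tendsto_nhdsWithin_iff.mpr
        ⟨continuous_ofLogCoord.continuousAt.tendsto.mono_left nhdsWithin_le_nhds, ?_⟩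
      filter_upwards [self_mem_nhdsWithin,
        nhdsWithin_le_nhds ((isOpen_horizontalStrip a).mem_nhds hz)] with w hw hwS
      refine ⟨ofLogCoord_mem_strip.mpr hwS, fun he => hw ?_⟩
      rw [mem_singleton_iff] at he ⊢
      rw [← logCoord_ofLogCoord w, he, logCoord_ofLogCoord]
    have hm := (hL.comp ht).mul (tendsto_slope_exp z)
    have hd : HasDerivAt (fun z => f (ofLogCoord z)) (L * Complex.exp z) z := by
      refine hasDerivAt_iff_tendsto_slope.mpr (hm.congr' ?_)
      filter_upwards [(tendsto_slope_exp z).eventually_ne (Complex.exp_ne_zero z)] with w hw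
      rw [slope_def_field] at hw ⊢
      have h1 := (div_ne_zero_iff.mp hw).1
      have h2 := (div_ne_zero_iff.mp hw).2
      simp only [Function.comp_apply, polarPoint_ofLogCoord, slope_def_field]
      field_simp
    exact hd.differentiableAt.differentiableWithinAt
  · intro hf p hp
    have hz := logCoord_mem_horizontalStrip hp
    have hd := ((hf _ hz).differentiableAt
      ((isOpen_horizontalStrip a).mem_nhds hz)).hasDerivAt
    have hq := (hasDerivAt_iff_tendsto_slope.mp hd).div (tendsto_slope_exp (logCoord p))
      (Complex.exp_ne_zero _)
    refine ⟨_, (hq.comp (f := logCoord) (x := 𝓝[strip a \ {p}] p)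
      (tendsto_nhdsWithin_iff.mpr ⟨?_, ?_⟩)).congr' ?_⟩
    · exact (continuousAt_logCoord hp.1).tendsto.mono_left nhdsWithin_le_nhds
    · filter_upwards [self_mem_nhdsWithin] with q hq he
      rw [mem_singleton_iff] at he
      exact hq.2 (by rw [mem_singleton_iff, ← ofLogCoord_logCoord hq.1.1, he,
        ofLogCoord_logCoord hp.1])
    · filter_upwards [self_mem_nhdsWithin] with q hq
      have hne : logCoord q - logCoord p ≠ 0 := fun he => hq.2 (by
        rw [mem_singleton_iff, ← ofLogCoord_logCoord hq.1.1, sub_eq_zero.mp he,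
          ofLogCoord_logCoord hp.1])
      simp only [Function.comp_apply, slope_def_field, ← polarPoint_ofLogCoord,
        ofLogCoord_logCoord hq.1.1, ofLogCoord_logCoord hp.1, Pi.div_apply]
      rw [div_div_div_cancel_right₀ hne]

theorem continuousOn_ofReal_cpow {s : ℂ} : ContinuousOn (fun r : ℝ => (r : ℂ) ^ s) (Ioi 0) :=
  fun r hr => (Complex.continuousAt_ofReal_cpow_const r s
    (Or.inr (ne_of_gt hr))).continuousWithinAt

theorem integral_exp_substitution {k : ℝ → ℂ} (hk : ContinuousOn k (Ioi 0)) (s : ℂ) (x₁ x₂ : ℝ) :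
    ∫ r in Real.exp x₁..Real.exp x₂, k r * (r : ℂ) ^ (s - 1) =
      ∫ x : ℝ in x₁..x₂, k (Real.exp x) * Complex.exp (s * x) := by
  have hpos : ∀ r ∈ Real.exp '' uIcc x₁ x₂, 0 < r := by
    rintro _ ⟨x, -, rfl⟩; exact Real.exp_pos x
  rw [← intervalIntegral.integral_deriv_smul_comp'' (f := Real.exp) (f' := Real.exp)
    (g := fun r : ℝ => k r * (r : ℂ) ^ (s - 1)) Real.continuous_exp.continuousOn
    (fun x _ => (Real.hasDerivAt_exp x).hasDerivWithinAt) Real.continuous_exp.continuousOn]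
  · refine intervalIntegral.integral_congr fun x _ => ?_
    simp only [Function.comp_apply, Complex.real_smul, Complex.ofReal_exp]
    rw [Complex.cpow_def_of_ne_zero (Complex.exp_ne_zero _), ← Complex.ofReal_exp,
      ← Complex.ofReal_log (Real.exp_pos x).le, Real.log_exp, Complex.ofReal_exp, mul_left_comm,
      ← Complex.exp_add]
    ring_nf
  · refine (hk.mono fun r hr => hpos r hr).mul (continuousOn_ofReal_cpow.mono hpos)

/-! ### The Mellin transform on the line `c + iℝ` -/

section MellinLine

variable {c : ℝ} {φ : ℝ → ℂ}

theorem norm_mellin_kernel (c t : ℝ) (φ : ℝ → ℂ) {x : ℝ} (hx : 0 < x) :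
    ‖φ x * (x : ℂ) ^ ((c : ℂ) + t * Complex.I - 1)‖ = ‖φ x * ((x ^ (c - 1) : ℝ) : ℂ)‖ := by
  rw [norm_mul, norm_mul, Complex.norm_cpow_eq_rpow_re_of_pos hx, Complex.norm_real,
    Real.norm_of_nonneg (Real.rpow_nonneg hx.le _)]
  simp

theorem integrableOn_mellin_kernel (hX : MemX c φ) (hφ : ContinuousOn φ (Ioi 0)) (t : ℝ) :
    IntegrableOn (fun x : ℝ => φ x * (x : ℂ) ^ ((c : ℂ) + t * Complex.I - 1)) (Ioi 0) := by
  refine Integrable.mono hX ?_ ?_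
  · refine ContinuousOn.aestronglyMeasurable (hφ.mul continuousOn_ofReal_cpow) measurableSet_Ioi
  · filter_upwards [self_mem_ae_restrict measurableSet_Ioi] with x hx
    exact (norm_mellin_kernel c t φ hx).le

theorem mellin_eq_integral_mul (φ : ℝ → ℂ) (s : ℂ) :
    mellin φ s = ∫ x in Ioi (0 : ℝ), φ x * (x : ℂ) ^ (s - 1) := by
  simp only [mellin, smul_eq_mul, mul_comm]

theorem norm_setIntegral_mellin_kernel_le (hX : MemX c φ) (t : ℝ) {S : Set ℝ} (hS : S ⊆ Ioi 0)
    (hSm : MeasurableSet S) :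
    ‖∫ x in S, φ x * (x : ℂ) ^ ((c : ℂ) + t * Complex.I - 1)‖ ≤
      ∫ x in Ioi (0 : ℝ), ‖φ x * ((x ^ (c - 1) : ℝ) : ℂ)‖ := by
  refine (norm_integral_le_integral_norm _).trans ?_
  rw [setIntegral_congr_fun hSm fun x hx => norm_mellin_kernel c t φ (hS hx)]
  exact setIntegral_mono_set hX.norm (Eventually.of_forall fun _ => norm_nonneg _)
    hS.eventuallyLE

theorem norm_mellin_le (hX : MemX c φ) (t : ℝ) :
    ‖mellin φ ((c : ℂ) + t * Complex.I)‖ ≤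
      ∫ x in Ioi (0 : ℝ), ‖φ x * ((x ^ (c - 1) : ℝ) : ℂ)‖ := by
  rw [mellin_eq_integral_mul]
  exact norm_setIntegral_mellin_kernel_le hX t subset_rfl measurableSet_Ioi

theorem norm_integral_exp_mul_le (hX : MemX c φ) (hφ : ContinuousOn φ (Ioi 0)) (t x₁ x₂ : ℝ) :
    ‖∫ x : ℝ in x₁..x₂, φ (Real.exp x) * Complex.exp (((c : ℂ) + t * Complex.I) * x)‖ ≤
      ∫ x in Ioi (0 : ℝ), ‖φ x * ((x ^ (c - 1) : ℝ) : ℂ)‖ := by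
  rw [← integral_exp_substitution hφ, intervalIntegral.norm_intervalIntegral_eq]
  refine norm_setIntegral_mellin_kernel_le hX t (fun x hx => ?_) measurableSet_uIoc
  exact (lt_min (Real.exp_pos _) (Real.exp_pos _)).trans hx.1

/-- The Mellin transform as a symmetric improper integral in the logarithmic variable. -/
theorem tendsto_integral_exp_mul_mellin (hX : MemX c φ) (hφ : ContinuousOn φ (Ioi 0)) (t : ℝ) :
    Tendsto (fun L : ℝ => ∫ x : ℝ in (-L)..L,
      φ (Real.exp x) * Complex.exp (((c : ℂ) + t * Complex.I) * x)) atTop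
      (𝓝 (mellin φ ((c : ℂ) + t * Complex.I))) := by
  have hcov : AECover (volume.restrict (Ioi (0 : ℝ))) atTop
      fun L : ℝ => Ioc (Real.exp (-L)) (Real.exp L) :=
    (aecover_Ioi_of_Ioi (Real.tendsto_exp_atBot.comp tendsto_neg_atTop_atBot)).inter
      ((aecover_Iic Real.tendsto_exp_atTop).mono Measure.restrict_le_self)
  rw [mellin_eq_integral_mul]
  refine (hcov.integral_tendsto_of_countably_generated
    (integrableOn_mellin_kernel hX hφ t)).congr' ?_
  filter_upwards [eventually_ge_atTop 0] with L hL
  rw [← integral_exp_substitution hφ, intervalIntegral.integral_of_le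
    (Real.exp_le_exp.mpr (by linarith)), Measure.restrict_restrict measurableSet_Ioc,
    inter_eq_self_of_subset_left (t := Ioi 0) fun x hx => (Real.exp_pos _).trans hx.1]

/-- In logarithmic coordinates the integrals of condition (d) are, up to a constant factor,
integrals along the line `Im z = θ` of one holomorphic function. -/
theorem integral_inv_self_eq {f : ℝ × ℝ → ℂ} {a θ : ℝ} (hf : PolarAnalyticOn f (strip a))
    (hθ : |θ| < a) (s : ℂ) {R : ℝ} (hR : 0 < R) :
    ∫ r in (1 / R)..R, f (r, θ) * (r : ℂ) ^ (s - 1) =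
      Complex.exp (-(s * (θ * Complex.I))) * ∫ x : ℝ in (-Real.log R)..Real.log R,
        f (ofLogCoord (x + θ * Complex.I)) * Complex.exp (s * (x + θ * Complex.I)) := by
  have hd := polarAnalyticOn_strip_iff.mp hf
  have hk : ContinuousOn (fun r : ℝ => f (r, θ)) (Ioi 0) := by
    have hc : ContinuousOn (fun r : ℝ => f (ofLogCoord (logCoord (r, θ)))) (Ioi 0) := by
      refine hd.continuousOn.comp (f := fun r : ℝ => logCoord (r, θ)) (fun r hr => ?_) fun r hr =>
        logCoord_mem_horizontalStrip ⟨hr, abs_lt.mp hθ⟩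
      exact (ContinuousAt.comp (f := fun r : ℝ => (r, θ)) (continuousAt_logCoord hr)
        (by fun_prop)).continuousWithinAt
    refine hc.congr fun r hr => ?_
    exact congrArg f (ofLogCoord_logCoord (p := (r, θ)) hr).symm
  have := integral_exp_substitution hk s (-Real.log R) (Real.log R)
  rw [Real.exp_neg, Real.exp_log hR, ← one_div] at this
  rw [this, ← intervalIntegral.integral_const_mul]
  refine intervalIntegral.integral_congr fun x _ => ?_
  have h1 : ofLogCoord (x + θ * Complex.I) = (Real.exp x, θ) := by simp [ofLogCoord]
  simp only [h1]
  rw [mul_left_comm, ← Complex.exp_add]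
  ring_nf

theorem differentiableOn_mul_exp {f : ℝ × ℝ → ℂ} {a : ℝ} (hf : PolarAnalyticOn f (strip a))
    (s : ℂ) : DifferentiableOn ℂ (fun z => f (ofLogCoord z) * Complex.exp (s * z))
      (horizontalStrip a) :=
  (polarAnalyticOn_strip_iff.mp hf).mul (by fun_prop)

theorem norm_mul_exp_le {f : ℝ × ℝ → ℂ} {b θ K : ℝ} (hθ : |θ| < b)
    (hK : ∀ p ∈ strip b, ‖f p‖ ≤ p.1 ^ (-c) * K) (t : ℝ) (z : ℂ) (hz : |z.im| ≤ |θ|) :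
    ‖f (ofLogCoord z) * Complex.exp (((c : ℂ) + t * Complex.I) * z)‖ ≤
      K * Real.exp (|t| * |θ|) := by
  have h1 := hK (ofLogCoord z) (ofLogCoord_mem_strip.mpr (hz.trans_lt hθ))
  have h2 : (ofLogCoord z).1 ^ (-c) = Real.exp (-(c * z.re)) := by
    rw [ofLogCoord, ← Real.exp_mul]; ring_nf
  rw [h2] at h1
  have hK0 : 0 ≤ K := by
    by_contra hneg
    have := mul_neg_of_pos_of_neg (Real.exp_pos (-(c * z.re))) (not_le.mp hneg)
    linarith [norm_nonneg (f (ofLogCoord z))]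
  have h3 : ‖Complex.exp (((c : ℂ) + t * Complex.I) * z)‖ =
      Real.exp (c * z.re) * Real.exp (-(t * z.im)) := by
    rw [Complex.norm_exp, ← Real.exp_add]; simp [sub_eq_add_neg]
  have h4 : -(t * z.im) ≤ |t| * |θ| := by
    refine (neg_le_abs _).trans ?_
    rw [abs_mul]; gcongr
  rw [norm_mul, h3]
  calc ‖f (ofLogCoord z)‖ * (Real.exp (c * z.re) * Real.exp (-(t * z.im)))
      ≤ (Real.exp (-(c * z.re)) * K) * (Real.exp (c * z.re) * Real.exp (|t| * |θ|)) := by gcongr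
    _ = (Real.exp (-(c * z.re)) * Real.exp (c * z.re)) * (K * Real.exp (|t| * |θ|)) := by ring
    _ = K * Real.exp (|t| * |θ|) := by rw [← Real.exp_add]; simp

/-- Condition (d) on the line `Im z = θ` bounds the transform by `K e^{-tθ}`, with `K` independent
of `θ`; the exponent `a|t|` is reached in the limit `θ → ±a`. -/
theorem exists_mellin_decay_of_memHStar {a : ℝ} {f : ℝ × ℝ → ℂ} (hX : MemX c φ)
    (hφ : ContinuousOn φ (Ioi 0)) (hf : MemHStar c a f) (hfφ : ∀ r : ℝ, 0 < r → f (r, 0) = φ r)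
    (ha : 0 < a) :
    ∃ K : ℝ, ∀ t : ℝ, ‖mellin φ ((c : ℂ) + t * Complex.I)‖ ≤ K * Real.exp (-(a * |t|)) := by
  obtain ⟨K, hK⟩ := hf.mellin_bounded
  have main : ∀ θ t : ℝ, |θ| < a →
      ‖mellin φ ((c : ℂ) + t * Complex.I)‖ ≤ K * Real.exp (-(θ * t)) := by
    intro θ t hθ
    obtain ⟨l, hl, hlK⟩ := hK θ (abs_lt.mp hθ) t
    set s : ℂ := (c : ℂ) + t * Complex.I with hs
    obtain ⟨M, hM⟩ := hf.bounded ((a - |θ|) / 2)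
      ⟨by linarith, by linarith [abs_nonneg θ]⟩
    have hl' : Tendsto (fun L : ℝ => ∫ x : ℝ in (-L)..L, f (ofLogCoord (x + θ * Complex.I)) *
        Complex.exp (s * (x + θ * Complex.I))) atTop
        (𝓝 (Complex.exp (s * (θ * Complex.I)) * l)) := by
      refine ((hl.comp Real.tendsto_exp_atTop).const_mul _).congr fun L => ?_
      simp only [Function.comp_apply]
      rw [integral_inv_self_eq hf.polarAnalytic hθ s (Real.exp_pos L), Real.log_exp, ← mul_assoc,
        ← Complex.exp_add, add_neg_cancel, Complex.exp_zero, one_mul]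
    have haxis : ∀ x : ℝ, f (ofLogCoord x) = φ (Real.exp x) := fun x => by
      rw [← hfφ _ (Real.exp_pos x)]; simp [ofLogCoord]
    have heq := horizontal_limits_eq (differentiableOn_mul_exp hf.polarAnalytic s) hθ
      (norm_mul_exp_le (by linarith) hM t)
      (fun L => by simpa only [haxis] using norm_integral_exp_mul_le hX hφ t 0 L)
      (by simpa only [haxis] using tendsto_integral_exp_mul_mellin hX hφ t) hl'
    rw [← heq, norm_mul, Complex.norm_exp, mul_comm]
    have hre : (s * (θ * Complex.I)).re = -(θ * t) := by simp [hs, mul_comm]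
    rw [hre]
    gcongr
  refine ⟨K, fun t => ?_⟩
  have hlim : Tendsto (fun b : ℝ => K * Real.exp (-(b * |t|))) (𝓝[<] a)
      (𝓝 (K * Real.exp (-(a * |t|)))) :=
    Tendsto.mono_left (Continuous.tendsto (by fun_prop) a) nhdsWithin_le_nhds
  refine ge_of_tendsto hlim ?_
  filter_upwards [Ioo_mem_nhdsLT ha] with b hb
  rcases abs_cases t with ⟨h1, -⟩ | ⟨h1, -⟩
  · rw [h1]
    exact main b t (by rw [abs_of_pos hb.1]; exact hb.2)
  · rw [h1, mul_neg, ← neg_mul]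
    exact main (-b) t (by rw [abs_neg, abs_of_pos hb.1]; exact hb.2)

end MellinLine

/-! ### The remainder as a trigonometric series -/

section Remainder

variable {c : ℝ} {φ : ℝ → ℂ}

theorem mellin_mellinTranslate_exp (c t u : ℝ) (φ : ℝ → ℂ) :
    mellin (mellinTranslate c (Real.exp u) φ) ((c : ℂ) + t * Complex.I) =
      mellin φ ((c : ℂ) + t * Complex.I) * Complex.exp (-(t * u * Complex.I)) := by
  have h1 : mellinTranslate c (Real.exp u) φ =
      fun x => ((Real.exp u ^ c : ℝ) : ℂ) • φ (Real.exp u * x) := rfl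
  rw [h1, mellin_const_smul, mellin_comp_mul_left _ _ (Real.exp_pos u), ← Real.exp_mul,
    smul_eq_mul, smul_eq_mul, ← mul_assoc, mul_comm (mellin φ _)]
  congr 1
  rw [Complex.cpow_def_of_ne_zero (by exact_mod_cast (Real.exp_pos u).ne'),
    ← Complex.ofReal_log (Real.exp_pos u).le, Real.log_exp, Complex.ofReal_exp, ← Complex.exp_add]
  push_cast
  ring_nf

theorem remainder_mellinTranslate_exp (c : ℝ) {σ : ℝ} (hσ : σ ≠ 0) (v : ℝ) (φ : ℝ → ℂ) :
    remainder c σ (mellinTranslate c (Real.exp (v / σ)) φ) =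
      -∑' k : {k : ℤ // k ≠ 0},
        mellin φ ((c : ℂ) + ((2 * Real.pi * (k : ℤ) * σ : ℝ) : ℂ) * Complex.I) *
          Complex.exp (-(2 * Real.pi * (k : ℤ) * v * Complex.I)) := by
  have hσ' : (σ : ℂ) ≠ 0 := by exact_mod_cast hσ
  rw [remainder]
  congr 1
  refine tsum_congr fun k => ?_
  rw [mellin_mellinTranslate_exp]
  congr 2
  push_cast
  field_simp

theorem integral_exp_int_period (n : ℤ) :
    ∫ v : ℝ in (-(1 / 2) : ℝ)..(1 / 2), Complex.exp (2 * Real.pi * n * Complex.I * v) =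
      if n = 0 then 1 else 0 := by
  split_ifs with hn
  · subst hn; norm_num
  · have h0 : (2 * Real.pi * n * Complex.I : ℂ) ≠ 0 := by
      simp [Real.pi_ne_zero, hn]
    rw [integral_exp_mul_complex h0, div_eq_zero_iff]
    left
    rw [sub_eq_zero, Complex.exp_eq_exp_iff_exists_int]
    exact ⟨n, by push_cast; ring⟩

/-- A coefficient of an absolutely convergent trigonometric series is bounded by the supremum of
the sum over a period, being an integral of the sum against a character. -/
theorem norm_coeff_le_of_norm_tsum_le {P : ℤ → Prop} {b : {k : ℤ // P k} → ℂ}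
    (hb : Summable fun k => ‖b k‖) {D : ℝ}
    (hD : ∀ v ∈ Icc (-(1 / 2) : ℝ) (1 / 2),
      ‖∑' k, b k * Complex.exp (-(2 * Real.pi * (k : ℤ) * v * Complex.I))‖ ≤ D)
    (m : {k : ℤ // P k}) : ‖b m‖ ≤ D := by
  have hnorm : ∀ (n : ℤ) (v : ℝ), ‖Complex.exp (2 * Real.pi * n * Complex.I * v)‖ = 1 :=
    fun n v => by
      rw [show (2 * Real.pi * n * Complex.I * v : ℂ) = ((2 * Real.pi * n * v : ℝ) : ℂ) * Complex.I
        by push_cast; ring, Complex.norm_exp_ofReal_mul_I]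
  have hnorm' : ∀ (n : ℤ) (v : ℝ), ‖Complex.exp (-(2 * Real.pi * n * v * Complex.I))‖ = 1 :=
    fun n v => by
      rw [show (-(2 * Real.pi * n * v * Complex.I) : ℂ) =
        ((-(2 * Real.pi * n * v) : ℝ) : ℂ) * Complex.I
        by push_cast; ring, Complex.norm_exp_ofReal_mul_I]
  have hs : ∀ v : ℝ, Summable fun k : {k : ℤ // P k} =>
      b k * Complex.exp (-(2 * Real.pi * (k : ℤ) * v * Complex.I)) := fun v =>
    Summable.of_norm (by simpa only [norm_mul, hnorm', mul_one] using hb)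
  have key := intervalIntegral.hasSum_integral_of_dominated_convergence
    (μ := volume) (a := -(1 / 2)) (b := 1 / 2)
    (F := fun (k : {k : ℤ // P k}) (v : ℝ) =>
      b k * Complex.exp (-(2 * Real.pi * (k : ℤ) * v * Complex.I)) *
        Complex.exp (2 * Real.pi * (m : ℤ) * Complex.I * v))
    (f := fun v => (∑' k, b k * Complex.exp (-(2 * Real.pi * (k : ℤ) * v * Complex.I))) *
        Complex.exp (2 * Real.pi * (m : ℤ) * Complex.I * v))
    (fun k _ => ‖b k‖) (fun k => Continuous.aestronglyMeasurable (by fun_prop))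
    (fun k => Eventually.of_forall fun v _ => by simp [hnorm, hnorm'])
    (Eventually.of_forall fun _ _ => hb) intervalIntegrable_const
    (Eventually.of_forall fun v _ => (hs v).hasSum.mul_right _)
  have hint : ∀ k : {k : ℤ // P k}, ∫ v : ℝ in (-(1 / 2) : ℝ)..(1 / 2),
      b k * Complex.exp (-(2 * Real.pi * (k : ℤ) * v * Complex.I)) *
        Complex.exp (2 * Real.pi * (m : ℤ) * Complex.I * v) = if k = m then b m else 0 := by
    intro k
    have : ∀ v : ℝ, b k * Complex.exp (-(2 * Real.pi * (k : ℤ) * v * Complex.I)) *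
        Complex.exp (2 * Real.pi * (m : ℤ) * Complex.I * v) =
        b k * Complex.exp (2 * Real.pi * ((m - k : ℤ) : ℂ) * Complex.I * v) := fun v => by
      rw [mul_assoc, ← Complex.exp_add]; push_cast; ring_nf
    simp only [this, intervalIntegral.integral_const_mul, integral_exp_int_period, sub_eq_zero]
    by_cases h : k = m
    · simp [h]
    · have : (m : ℤ) ≠ k := fun h' => h (Subtype.ext h'.symm)
      simp [h, this]
  simp only [hint] at key
  rw [(hasSum_ite_eq m (b m)).unique key]
  have := intervalIntegral.norm_integral_le_of_norm_le_const (a := -(1 / 2)) (b := 1 / 2)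
    (f := fun v : ℝ => (∑' k, b k * Complex.exp (-(2 * Real.pi * (k : ℤ) * v * Complex.I))) *
        Complex.exp (2 * Real.pi * (m : ℤ) * Complex.I * v)) (C := D) fun v hv => by
      rw [norm_mul, hnorm, mul_one]
      rw [uIoc_of_le (by norm_num)] at hv
      exact hD v ⟨hv.1.le, hv.2⟩
  norm_num at this ⊢
  exact this

/-- The translates `h ∈ [e^{-1/(2σ)}, e^{1/(2σ)}]` cover a full period of the remainder, so a
uniform bound on it bounds its Fourier coefficients; the ones of index `±1` are the values of the
Mellin transform at `c ± 2πiσ`. -/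
theorem exists_mellin_decay_of_remainder {s a : ℝ} (ha : 0 < a) (hK : MemK c s φ)
    (hR : ∃ C σ₀ : ℝ, 0 < σ₀ ∧ ∀ σ : ℝ, σ₀ ≤ σ →
        ∀ h ∈ Set.Icc (Real.exp (-1 / (2 * σ))) (Real.exp (1 / (2 * σ))),
          ‖remainder c σ (mellinTranslate c h φ)‖ ≤ C * Real.exp (-2 * Real.pi * a * σ)) :
    ∃ K : ℝ, ∀ t : ℝ, ‖mellin φ ((c : ℂ) + t * Complex.I)‖ ≤ K * Real.exp (-(a * |t|)) := by
  obtain ⟨C, σ₀, hσ₀, hC⟩ := hR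
  have hlarge : ∀ σ : ℝ, max σ₀ s ≤ σ → ∀ k : {k : ℤ // k ≠ 0},
      ‖mellin φ ((c : ℂ) + ((2 * Real.pi * (k : ℤ) * σ : ℝ) : ℂ) * Complex.I)‖ ≤
        C * Real.exp (-2 * Real.pi * a * σ) := by
    intro σ hσ
    have h0 : σ₀ ≤ σ := (le_max_left _ _).trans hσ
    have hpos : 0 < σ := hσ₀.trans_le h0
    refine norm_coeff_le_of_norm_tsum_le
      ((hK.summable_mellin σ ((le_max_right _ _).trans hσ)).subtype _) fun v hv => ?_
    have := hC σ h0 (Real.exp (v / σ)) ⟨?_, ?_⟩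
    · rwa [remainder_mellinTranslate_exp c hpos.ne', norm_neg] at this
    · rw [Real.exp_le_exp, div_le_div_iff₀ (by positivity) hpos]
      nlinarith [hv.1]
    · rw [Real.exp_le_exp, div_le_div_iff₀ hpos (by positivity)]
      nlinarith [hv.2]
  set A := ∫ x in Ioi (0 : ℝ), ‖φ x * ((x ^ (c - 1) : ℝ) : ℂ)‖ with hA
  have hA0 : 0 ≤ A := integral_nonneg fun _ => norm_nonneg _
  set T := 2 * Real.pi * max σ₀ s with hT
  -- `T` is where the asymptotic bound takes over; below it, boundedness of the transform suffices.
  refine ⟨max C (A * Real.exp (a * T)), fun t => ?_⟩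
  rcases le_or_gt T |t| with ht | ht
  · have hσ : max σ₀ s ≤ |t| / (2 * Real.pi) := by
      rw [le_div_iff₀ (by positivity)]; linarith
    have hexp : -2 * Real.pi * a * (|t| / (2 * Real.pi)) = -(a * |t|) := by
      field_simp
    have hstep : ‖mellin φ ((c : ℂ) + t * Complex.I)‖ ≤ C * Real.exp (-(a * |t|)) := by
      rcases abs_cases t with ⟨h1, -⟩ | ⟨h1, -⟩
      · have h2 := hlarge _ hσ ⟨1, by norm_num⟩
        have h3 : 2 * Real.pi * ((1 : ℤ) : ℝ) * (|t| / (2 * Real.pi)) = t := by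
          rw [h1]; push_cast; field_simp
        rwa [h3, hexp] at h2
      · have h2 := hlarge _ hσ ⟨-1, by norm_num⟩
        have h3 : 2 * Real.pi * ((-1 : ℤ) : ℝ) * (|t| / (2 * Real.pi)) = t := by
          rw [h1]; push_cast; field_simp
        rwa [h3, hexp] at h2
    exact hstep.trans (by gcongr; exact le_max_left _ _)
  · calc ‖mellin φ ((c : ℂ) + t * Complex.I)‖ ≤ A := norm_mellin_le hK.memX t
      _ = A * Real.exp (a * T) * Real.exp (-(a * T)) := by
        rw [mul_assoc, ← Real.exp_add]; simp
      _ ≤ max C (A * Real.exp (a * T)) * Real.exp (-(a * |t|)) := by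
        gcongr
        exact le_max_right _ _

theorem summable_exp_neg_mul_abs_int {q : ℝ} (hq : 0 < q) :
    Summable fun k : ℤ => Real.exp (-(q * |(k : ℝ)|)) := by
  have h : Summable fun n : ℕ => Real.exp (-(q * |((n : ℤ) : ℝ)|)) := by
    simpa [mul_comm] using Real.summable_exp_nat_mul_iff.mpr (neg_lt_zero.mpr hq)
  refine Summable.of_nat_of_neg h ?_
  simpa using h

theorem exists_remainder_bound_of_mellin_decay {a K : ℝ} (ha : 0 < a)
    (hdecay : ∀ t : ℝ, ‖mellin φ ((c : ℂ) + t * Complex.I)‖ ≤ K * Real.exp (-(a * |t|))) :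
    ∃ C σ₀ : ℝ, 0 < σ₀ ∧ ∀ σ : ℝ, σ₀ ≤ σ →
        ∀ h ∈ Set.Icc (Real.exp (-1 / (2 * σ))) (Real.exp (1 / (2 * σ))),
          ‖remainder c σ (mellinTranslate c h φ)‖ ≤ C * Real.exp (-2 * Real.pi * a * σ) := by
  have hK0 : 0 ≤ K := by simpa using (norm_nonneg _).trans (hdecay 0)
  set q : ℝ := 2 * Real.pi * a with hq
  have hq0 : 0 < q := by positivity
  have hsum : Summable fun k : {k : ℤ // k ≠ 0} => Real.exp (-(q * |((k : ℤ) : ℝ)|)) :=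
    (summable_exp_neg_mul_abs_int hq0).subtype _
  refine ⟨K * (Real.exp q * ∑' k : {k : ℤ // k ≠ 0}, Real.exp (-(q * |((k : ℤ) : ℝ)|))), 1,
    one_pos, fun σ hσ h hh => ?_⟩
  have hσ0 : σ ≠ 0 := by positivity
  have hh0 : 0 < h := (Real.exp_pos _).trans_le hh.1
  obtain ⟨v, rfl⟩ : ∃ v, h = Real.exp (v / σ) :=
    ⟨σ * Real.log h, by rw [mul_div_cancel_left₀ _ hσ0, Real.exp_log hh0]⟩
  rw [remainder_mellinTranslate_exp c hσ0, norm_neg]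
  have hterm : ∀ k : {k : ℤ // k ≠ 0},
      ‖mellin φ ((c : ℂ) + ((2 * Real.pi * (k : ℤ) * σ : ℝ) : ℂ) * Complex.I) *
          Complex.exp (-(2 * Real.pi * (k : ℤ) * v * Complex.I))‖ ≤
        K * Real.exp q * Real.exp (-2 * Real.pi * a * σ) *
          Real.exp (-(q * |((k : ℤ) : ℝ)|)) := by
    intro k
    have hexp : K * Real.exp q * Real.exp (-2 * Real.pi * a * σ) *
        Real.exp (-(q * |((k : ℤ) : ℝ)|)) =
        K * Real.exp (q + -2 * Real.pi * a * σ + -(q * |((k : ℤ) : ℝ)|)) := by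
      rw [Real.exp_add, Real.exp_add]; ring
    rw [norm_mul, show (-(2 * Real.pi * (k : ℤ) * v * Complex.I) : ℂ) =
      ((-(2 * Real.pi * (k : ℤ) * v) : ℝ) : ℂ) * Complex.I by push_cast; ring,
      Complex.norm_exp_ofReal_mul_I, mul_one, hexp]
    refine (hdecay _).trans ?_
    gcongr
    have hk : (1 : ℝ) ≤ |((k : ℤ) : ℝ)| := by exact_mod_cast Int.one_le_abs k.2
    rw [abs_mul, abs_mul, abs_of_pos (by positivity : (0 : ℝ) < 2 * Real.pi),
      abs_of_pos (by positivity : 0 < σ)]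
    -- For `|k| ≥ 1` and `σ ≥ 1` one has `σ |k| ≥ σ + |k| - 1`
    nlinarith [mul_nonneg hq0.le (mul_nonneg (sub_nonneg.mpr hk) (sub_nonneg.mpr hσ))]
  refine (tsum_of_norm_bounded (hsum.mul_left _).hasSum hterm).trans (le_of_eq ?_)
  rw [tsum_mul_left]
  ring

end Remainder

/-! ### Fourier integrals of exponentially decaying functions -/

theorem integrable_exp_neg_mul_abs {b : ℝ} (hb : 0 < b) :
    Integrable fun t : ℝ => Real.exp (-(b * |t|)) := by
  rw [← integrableOn_univ, ← Iic_union_Ioi (a := (0 : ℝ))]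
  refine IntegrableOn.union ?_ ?_
  · refine (integrableOn_exp_mul_Iic hb 0).congr_fun (fun t ht => ?_) measurableSet_Iic
    simp [abs_of_nonpos (mem_Iic.mp ht)]
  · refine (integrableOn_exp_mul_Ioi (neg_lt_zero.mpr hb) 0).congr_fun (fun t ht => ?_)
      measurableSet_Ioi
    simp [abs_of_pos (mem_Ioi.mp ht)]

/-- The Fourier integral `∫ G(t) e^{-itz} dt` at a complex point `z`. -/
noncomputable def fourierExtension (G : ℝ → ℂ) (z : ℂ) : ℂ :=
  ∫ t : ℝ, G t * Complex.exp (-(t * z * Complex.I))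

section FourierExtension

variable {G : ℝ → ℂ} {a K : ℝ}

theorem norm_exp_neg_mul_I (t : ℝ) (z : ℂ) :
    ‖Complex.exp (-(t * z * Complex.I))‖ = Real.exp (t * z.im) := by
  rw [Complex.norm_exp]; simp

theorem norm_fourierExtension_integrand_le (hdecay : ∀ t : ℝ, ‖G t‖ ≤ K * Real.exp (-(a * |t|)))
    {b : ℝ} {z : ℂ} (hz : |z.im| ≤ b) (t : ℝ) :
    ‖G t * Complex.exp (-(t * z * Complex.I))‖ ≤ K * Real.exp (-((a - b) * |t|)) := by
  have hK0 : 0 ≤ K := by simpa using (norm_nonneg _).trans (hdecay 0)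
  have h1 : t * z.im ≤ b * |t| := by
    calc t * z.im ≤ |t * z.im| := le_abs_self _
      _ = |z.im| * |t| := by rw [abs_mul, mul_comm]
      _ ≤ b * |t| := by gcongr
  rw [norm_mul, norm_exp_neg_mul_I]
  calc ‖G t‖ * Real.exp (t * z.im)
      ≤ K * Real.exp (-(a * |t|)) * Real.exp (b * |t|) := by gcongr; exact hdecay t
    _ = K * Real.exp (-((a - b) * |t|)) := by rw [mul_assoc, ← Real.exp_add]; ring_nf

theorem integrable_fourierExtension_integrand (hG : AEStronglyMeasurable G)
    (hdecay : ∀ t : ℝ, ‖G t‖ ≤ K * Real.exp (-(a * |t|))) {z : ℂ} (hz : |z.im| < a) :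
    Integrable fun t : ℝ => G t * Complex.exp (-(t * z * Complex.I)) :=
  ((integrable_exp_neg_mul_abs (sub_pos.mpr hz)).const_mul K).mono'
    (hG.mul (Continuous.aestronglyMeasurable (by fun_prop)))
    (Eventually.of_forall (norm_fourierExtension_integrand_le hdecay le_rfl))

theorem norm_fourierExtension_le (hdecay : ∀ t : ℝ, ‖G t‖ ≤ K * Real.exp (-(a * |t|)))
    {b : ℝ} (hb : b < a) {z : ℂ} (hz : |z.im| ≤ b) :
    ‖fourierExtension G z‖ ≤ ∫ t : ℝ, K * Real.exp (-((a - b) * |t|)) :=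
  norm_integral_le_of_norm_le ((integrable_exp_neg_mul_abs (sub_pos.mpr hb)).const_mul K)
    (Eventually.of_forall (norm_fourierExtension_integrand_le hdecay hz))

theorem differentiableOn_fourierExtension (hG : AEStronglyMeasurable G)
    (hdecay : ∀ t : ℝ, ‖G t‖ ≤ K * Real.exp (-(a * |t|))) :
    DifferentiableOn ℂ (fourierExtension G) (horizontalStrip a) := by
  intro z₀ hz₀
  have hz₀' : |z₀.im| < a := hz₀
  have hK0 : 0 ≤ K := by simpa using (norm_nonneg _).trans (hdecay 0)
  obtain ⟨b, hb₀, hb⟩ := exists_between hz₀'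
  set δ := a - b with hδ
  have hδ0 : 0 < δ := sub_pos.mpr hb
  have key := hasDerivAt_integral_of_dominated_loc_of_deriv_le (μ := volume)
    (F := fun (z : ℂ) (t : ℝ) => G t * Complex.exp (-(t * z * Complex.I)))
    (F' := fun (z : ℂ) (t : ℝ) =>
      G t * Complex.exp (-(t * z * Complex.I)) * -(t * Complex.I))
    (bound := fun t : ℝ => 2 / δ * (K * Real.exp (-(δ / 2 * |t|))))
    ((isOpen_horizontalStrip b).mem_nhds hb₀)
    (Eventually.of_forall fun z => hG.mul (Continuous.aestronglyMeasurable (by fun_prop)))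
    (integrable_fourierExtension_integrand hG hdecay hz₀')
    ((hG.mul (Continuous.aestronglyMeasurable (by fun_prop))).mul
      (Continuous.aestronglyMeasurable (by fun_prop)))
    (Eventually.of_forall fun t z hz => ?_)
    (((integrable_exp_neg_mul_abs (by positivity)).const_mul K).const_mul _)
    (Eventually.of_forall fun t z _ => ?_)
  · exact key.2.differentiableAt.differentiableWithinAt
  · have h1 := norm_fourierExtension_integrand_le hdecay (b := b) (le_of_lt hz) t
    -- Half of the exponential decay absorbs the factor `|t|`
    have h2 : |t| ≤ 2 / δ * Real.exp (δ / 2 * |t|) := by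
      have := Real.add_one_le_exp (δ / 2 * |t|)
      calc |t| = 2 / δ * (δ / 2 * |t|) := by field_simp
        _ ≤ 2 / δ * Real.exp (δ / 2 * |t|) := by gcongr; linarith
    rw [norm_mul, norm_neg, norm_mul (t : ℂ), Complex.norm_I, mul_one, Complex.norm_real,
      Real.norm_eq_abs]
    calc _ ≤ (K * Real.exp (-(δ * |t|))) * (2 / δ * Real.exp (δ / 2 * |t|)) := by gcongr
      _ = 2 / δ * (K * (Real.exp (-(δ * |t|)) * Real.exp (δ / 2 * |t|))) := by ring
      _ = 2 / δ * (K * Real.exp (-(δ / 2 * |t|))) := by rw [← Real.exp_add]; ring_nf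
  · have h1 : HasDerivAt (fun z : ℂ => -(t * z * Complex.I)) (-(t * Complex.I)) z := by
      simpa using (((hasDerivAt_id z).const_mul (t : ℂ)).mul_const Complex.I).fun_neg
    simpa [mul_assoc] using (h1.cexp).const_mul (G t)

/-- Riemann–Lebesgue on each horizontal line. -/
theorem tendsto_fourierExtension_cocompact (G : ℝ → ℂ) (y : ℝ) :
    Tendsto (fun x : ℝ => fourierExtension G (x + y * Complex.I)) (cocompact ℝ) (𝓝 0) := by
  have h := Real.tendsto_integral_exp_smul_cocompact
    fun t : ℝ => G t * Complex.exp (t * y)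
  have hpi : (2 * Real.pi)⁻¹ ≠ 0 := by positivity
  have hsc : Tendsto (fun x : ℝ => (2 * Real.pi)⁻¹ * x) (cocompact ℝ) (cocompact ℝ) :=
    (Homeomorph.mulLeft₀ _ hpi).isClosedEmbedding.tendsto_cocompact
  refine (h.comp hsc).congr fun x => ?_
  simp only [Function.comp_apply, fourierExtension]
  refine integral_congr_ae (Eventually.of_forall fun t => ?_)
  simp only [Circle.smul_def, Real.fourierChar_apply, smul_eq_mul]
  rw [mul_left_comm, ← Complex.exp_add]
  congr 2
  have : (Real.pi : ℂ) ≠ 0 := by exact_mod_cast Real.pi_ne_zero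
  push_cast
  field_simp
  linear_combination ((t : ℂ) * y) * Complex.I_sq

end FourierExtension

/-! ### The extension of `φ` to the strip -/

/-- The function `(1 / 2π) ∫ [φ]^(c + it) z^{-(c + it)} dt` in polar coordinates: the inverse
Mellin transform of `[φ]^`, continued to the strip. -/
noncomputable def mellinExtension (c : ℝ) (φ : ℝ → ℂ) (p : ℝ × ℝ) : ℂ :=
  1 / (2 * Real.pi) * (Complex.exp (-(c * logCoord p)) *
    fourierExtension (fun t : ℝ => mellin φ ((c : ℂ) + t * Complex.I)) (logCoord p))

section MellinExtension

variable {c a K : ℝ} {φ : ℝ → ℂ}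

theorem mellinExtension_axis (hM : MemInversionClass c φ) {r : ℝ} (hr : 0 < r) :
    mellinExtension c φ (r, 0) = φ r := by
  have hconv : MellinConvergent φ (c : ℂ) := by
    have := integrableOn_mellin_kernel hM.memX hM.continuousOn 0
    simpa [MellinConvergent, mul_comm] using this
  rw [← mellinInv_mellin_eq c φ hr hconv hM.integrable_mellin
    (hM.continuousOn.continuousAt (Ioi_mem_nhds hr)), mellinInv, mellinExtension, fourierExtension,
    ← integral_const_mul, Complex.real_smul]
  push_cast
  congr 1
  refine integral_congr_ae (Eventually.of_forall fun t => ?_)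
  simp only [smul_eq_mul, logCoord]
  rw [Complex.cpow_def_of_ne_zero (by exact_mod_cast hr.ne'), ← Complex.ofReal_log hr.le,
    mul_left_comm, ← Complex.exp_add, mul_comm]
  congr 2
  push_cast
  ring

theorem mellinExtension_ofLogCoord (z : ℂ) :
    mellinExtension c φ (ofLogCoord z) = 1 / (2 * Real.pi) * (Complex.exp (-(c * z)) *
      fourierExtension (fun t : ℝ => mellin φ ((c : ℂ) + t * Complex.I)) z) := by
  rw [mellinExtension, logCoord_ofLogCoord]

/-- Multiplying by `e^{(c + it) z}` cancels the factor `e^{-cz}`; the remaining exponential is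
bounded on horizontal lines, on which the Fourier integral vanishes at infinity. -/
theorem tendsto_mellinExtension_mul_exp (c : ℝ) (φ : ℝ → ℂ) (t y : ℝ) :
    Tendsto (fun x : ℝ => mellinExtension c φ (ofLogCoord (x + y * Complex.I)) *
      Complex.exp (((c : ℂ) + t * Complex.I) * (x + y * Complex.I))) (cocompact ℝ) (𝓝 0) := by
  have h := (tendsto_fourierExtension_cocompact
    (fun t : ℝ => mellin φ ((c : ℂ) + t * Complex.I)) y).norm.const_mul
      (1 / (2 * Real.pi) * Real.exp (-(t * y)))
  rw [norm_zero, mul_zero] at h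
  refine squeeze_zero_norm (fun x => le_of_eq ?_) h
  have h1 : ∀ F : ℂ, 1 / (2 * Real.pi) * (Complex.exp (-(c * (x + y * Complex.I))) * F) *
      Complex.exp (((c : ℂ) + t * Complex.I) * (x + y * Complex.I)) =
      ((1 / (2 * Real.pi) : ℝ) : ℂ) * Complex.exp (t * Complex.I * (x + y * Complex.I)) * F := by
    intro F
    rw [add_mul, Complex.exp_add, Complex.exp_neg]
    have := Complex.exp_ne_zero (c * (x + y * Complex.I))
    push_cast
    field_simp
  rw [mellinExtension_ofLogCoord, h1, norm_mul, norm_mul, Complex.norm_real,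
    Real.norm_of_nonneg (by positivity), Complex.norm_exp]
  simp

theorem memHStar_mellinExtension (hM : MemInversionClass c φ)
    (hdecay : ∀ t : ℝ, ‖mellin φ ((c : ℂ) + t * Complex.I)‖ ≤ K * Real.exp (-(a * |t|))) :
    MemHStar c a (mellinExtension c φ) := by
  have hmeas := hM.integrable_mellin.aestronglyMeasurable
  have hpolar : PolarAnalyticOn (mellinExtension c φ) (strip a) := by
    rw [polarAnalyticOn_strip_iff]
    simp only [mellinExtension_ofLogCoord]
    exact (DifferentiableOn.mul (by fun_prop)
      (differentiableOn_fourierExtension hmeas hdecay)).const_mul _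
  have hbdd : ∀ ε ∈ Ioo 0 a, ∃ K : ℝ, ∀ p ∈ strip (a - ε),
      ‖mellinExtension c φ p‖ ≤ p.1 ^ (-c) * K := by
    intro ε hε
    refine ⟨1 / (2 * Real.pi) * ∫ t : ℝ, K * Real.exp (-((a - (a - ε)) * |t|)), fun p hp => ?_⟩
    have h1 : ‖Complex.exp (-(c * logCoord p))‖ = p.1 ^ (-c) := by
      rw [Complex.norm_exp, Real.rpow_def_of_pos hp.1]
      simp [logCoord, mul_comm]
    have h2 := norm_fourierExtension_le hdecay (b := a - ε) (by linarith [hε.1])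
      (le_of_lt (logCoord_mem_horizontalStrip hp))
    rw [mellinExtension, norm_mul, norm_mul, h1, mul_left_comm]
    have h3 : ‖(1 / (2 * Real.pi) : ℂ)‖ = 1 / (2 * Real.pi) := by
      simp [abs_of_pos Real.pi_pos]
    rw [h3]
    have h4 : 0 ≤ p.1 ^ (-c) := Real.rpow_nonneg (le_of_lt hp.1) _
    gcongr
  have haxis : ∀ l : Filter ℝ, Tendsto Real.log l (cocompact ℝ) → (∀ᶠ r in l, 0 < r) →
      Tendsto (fun r : ℝ => ((r ^ c : ℝ) : ℂ) * mellinExtension c φ (r, 0)) l (𝓝 0) := by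
    intro l hl hpos
    refine ((tendsto_mellinExtension_mul_exp c φ 0 0).comp hl).congr' ?_
    filter_upwards [hpos] with r hr
    have h1 : ofLogCoord (Real.log r) = (r, 0) := by
      simp [ofLogCoord, Real.exp_log hr]
    have h2 : ((r ^ c : ℝ) : ℂ) = Complex.exp (c * Real.log r) := by
      rw [Real.rpow_def_of_pos hr, mul_comm]; push_cast; rfl
    simp only [Function.comp_apply, Complex.ofReal_zero, zero_mul, add_zero, h1, h2]
    rw [mul_comm]
  refine ⟨hpolar, haxis _ ?_ self_mem_nhdsWithin, haxis _ ?_ (eventually_gt_atTop 0), hbdd,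
    K, fun θ hθ t => ?_⟩
  · rw [cocompact_eq_atBot_atTop]
    exact Real.tendsto_log_nhdsGT_zero.mono_right le_sup_left
  · rw [cocompact_eq_atBot_atTop]
    exact Real.tendsto_log_atTop.mono_right le_sup_right
  · have hθ' : |θ| < a := abs_lt.mpr hθ
    have hK0 : 0 ≤ K := by simpa using (norm_nonneg _).trans (hdecay 0)
    set s : ℂ := (c : ℂ) + t * Complex.I with hs
    obtain ⟨M, hMb⟩ := hbdd ((a - |θ|) / 2) ⟨by linarith, by linarith [abs_nonneg θ]⟩
    have hline : ∀ x : ℝ, mellinExtension c φ (ofLogCoord x) = φ (Real.exp x) := fun x => by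
      rw [← mellinExtension_axis hM (Real.exp_pos x)]; simp [ofLogCoord]
    have hshift := tendsto_integral_shift (differentiableOn_mul_exp hpolar s) hθ'
      (norm_mul_exp_le (by linarith) hMb t)
      (fun y _ => tendsto_mellinExtension_mul_exp c φ t y)
      (by simpa only [hline] using tendsto_integral_exp_mul_mellin hM.memX hM.continuousOn t)
    refine ⟨Complex.exp (-(s * (θ * Complex.I))) * mellin φ s,
      ((hshift.comp Real.tendsto_log_atTop).const_mul _).congr' ?_, ?_⟩
    · filter_upwards [eventually_gt_atTop 0] with R hR
      exact (integral_inv_self_eq hpolar hθ' s hR).symm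
    · have hre : (-(s * (θ * Complex.I))).re = θ * t := by simp [hs, mul_comm]
      have hle : θ * t ≤ a * |t| := by
        calc θ * t ≤ |θ * t| := le_abs_self _
          _ = |θ| * |t| := abs_mul _ _
          _ ≤ a * |t| := by gcongr
      rw [norm_mul, Complex.norm_exp, hre]
      calc Real.exp (θ * t) * ‖mellin φ s‖
          ≤ Real.exp (a * |t|) * (K * Real.exp (-(a * |t|))) := by gcongr; exact hdecay t
        _ = K * (Real.exp (a * |t|) * Real.exp (-(a * |t|))) := by ring
        _ = K := by rw [← Real.exp_add]; simp

end MellinExtension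

end MellinQuadrature

theorem mainTheorem5 (c s a : ℝ) (hs : 0 < s) (ha : 0 < a) (φ : ℝ → ℂ)
    (hK : MellinQuadrature.MemK c s φ) (hM : MellinQuadrature.MemInversionClass c φ) :
    (∃ f : ℝ × ℝ → ℂ, MellinQuadrature.MemHStar c a f ∧ ∀ r : ℝ, 0 < r → f (r, 0) = φ r) ↔
      ∃ C σ₀ : ℝ, 0 < σ₀ ∧ ∀ σ : ℝ, σ₀ ≤ σ →
        ∀ h ∈ Set.Icc (Real.exp (-1 / (2 * σ))) (Real.exp (1 / (2 * σ))),
          ‖MellinQuadrature.remainder c σ (MellinQuadrature.mellinTranslate c h φ)‖ ≤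
            C * Real.exp (-2 * Real.pi * a * σ) := by
  constructor
  · rintro ⟨f, hf, hfφ⟩
    obtain ⟨K, hdecay⟩ :=
      MellinQuadrature.exists_mellin_decay_of_memHStar hM.memX hM.continuousOn hf hfφ ha
    exact MellinQuadrature.exists_remainder_bound_of_mellin_decay ha hdecay
  · intro hR
    obtain ⟨K, hdecay⟩ := MellinQuadrature.exists_mellin_decay_of_remainder ha hK hR
    exact ⟨MellinQuadrature.mellinExtension c φ,
      MellinQuadrature.memHStar_mellinExtension hM hdecay,
      fun r hr => MellinQuadrature.mellinExtension_axis hM hr⟩
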